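/- Call a function $f\colon\mathbb{N}\to\mathbb{N}$ submultiplicative if $f(m+n)\le f(m)f(n)$ for all $m,n\ge 1$. For $f,g\colon\mathbb{N}\to\mathbb{N}$ write $f\preceq g$ if there are constants $C,D>0$ (which may be taken to be integers) such that $f(n)\le C\,g(Dn)$ for all sufficiently large $n$. A $\mathbb{Z}$-subshift over a finite alphabet $\Sigma$ is a non-empty closed subset $\mathcal{X}\subseteq\Sigma^{\mathbb{Z}}$ invariant under the shift $T(w)[i]=w[i+1]$ and its inverse. It is minimal if it contains no subshift other than itself, uniquely ergodic if $T|_{\mathcal X}$ has exactly one invariant Borel probability measure, and strictly ergodic if it is both. Its complexity function $p_{\mathcal{X}}(n)$ is the number of words of length $n$ that occur as factors of elements of $\mathcal{X}$. **Theorem 1.3.** Let $f\colon\mathbb{N}\to\mathbb{N}$ be a non-decreasing, submultiplicative function that is not identically zero. Then there exist a finite alphabet $\Sigma$ and a strictly ergodic $\mathbb{Z}$-subshift $\mathcal{X}\subseteq\Sigma^{\mathbb{Z}}$ such that $$f(n)\preceq p_{\mathcal{X}}(n)\preceq n f(n).$$ -/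

import Mathlib

open SymbolicDynamics.FullShift MeasureTheory

/-- Submultiplicativity of `f` on the positive integers: `f (m + n) ≤ f m * f n`.
Nothing is required of the value `f 0`. -/
def Submultiplicative (f : ℕ → ℕ) : Prop :=
  ∀ m n : ℕ, 1 ≤ m → 1 ≤ n → f (m + n) ≤ f m * f n

/-- Asymptotic domination of growth functions: there are constants `C, D > 0` such that
`f n ≤ C * g (D * n)` for all large `n`. -/
def AsympLE (f g : ℕ → ℕ) : Prop :=
  ∃ C D : ℕ, 0 < C ∧ 0 < D ∧ ∀ᶠ n : ℕ in Filter.atTop, f n ≤ C * g (D * n)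

/-- A homeomorphism is uniquely ergodic if it has exactly one invariant Borel probability
measure. -/
def UniquelyErgodic {Y : Type*} [TopologicalSpace Y] [MeasurableSpace Y] [BorelSpace Y]
    (T : Y ≃ₜ Y) : Prop :=
  ∃! μ : Measure Y, IsProbabilityMeasure μ ∧ MeasurePreserving T μ μ

/-- The shift `(T x) i = x (i + 1)` as a homeomorphism of a `ℤ`-subshift. -/
def shiftHomeomorph {A : Type*} [TopologicalSpace A] (X : Subshift A ℤ) :
    X.carrier ≃ₜ X.carrier where
  toFun x := ⟨shift 1 x.1, X.mapsTo 1 x.2⟩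
  invFun x := ⟨shift (-1) x.1, X.mapsTo (-1) x.2⟩
  left_inv x := by ext i; simp
  right_inv x := by ext i; simp
  continuous_toFun := by fun_prop
  continuous_invFun := by fun_prop

/-- A subshift is minimal if it is nonempty and contains no nonempty subshift other than
itself. -/
def MinimalSubshift {A : Type*} [TopologicalSpace A] (X : Subshift A ℤ) : Prop :=
  X.carrier.Nonempty ∧
    ∀ Z : Subshift A ℤ, Z.carrier.Nonempty → Z.carrier ⊆ X.carrier → Z.carrier = X.carrier

/-- A subshift is strictly ergodic if it is minimal and its shift map is uniquely ergodic. -/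
def StrictlyErgodic {A : Type*} [TopologicalSpace A] [MeasurableSpace A] (X : Subshift A ℤ)
    [BorelSpace X.carrier] : Prop :=
  MinimalSubshift X ∧ UniquelyErgodic (shiftHomeomorph X)

/-- The words of length `n` that occur as factors of some element of `X`. -/
def factors {A : Type*} [TopologicalSpace A] (X : Subshift A ℤ) (n : ℕ) : Set (Fin n → A) :=
  {u | ∃ x ∈ X.carrier, ∃ i : ℤ, ∀ j : Fin n, u j = x (i + (j : ℕ))}

/-- The complexity function of a subshift: the number of its factors of length `n`. -/
noncomputable def complexity {A : Type*} [TopologicalSpace A] (X : Subshift A ℤ) (n : ℕ) : ℕ :=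
  (factors X n).ncard

/-! Write W_k for the level-k `blocks`, words of length 2^k, and C_k ⊆ W_k for the `heads`; put
W_{k+1} = C_k W_k. As |W_{k+1}| = |C_k| |W_k|, the bound f(2^{k+1}) ≤ f(2^k)^2 allows |C_k| to be
chosen so that 2 f(2^k) ≤ |W_k| ≤ 4 f(2^k) at every level, with C_k never more than about half of
W_k. The subshift consists of the sequences all of whose factors occur in blocks.

Which half to take is free, and this freedom gives strict ergodicity. At some levels C_k is chosen
on one side of the mid-range of the number of occurrences of a word u. This contracts the relative
oscillation (`Balancing.exists_oscLE`), so u has a uniform frequency, whence unique ergodicity. At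
other levels C_k lies inside the set of blocks containing u, or contains that set. This forces each
word of the language into all blocks of some level (`Spreading.exists_forall_infix`), whence
minimality. Every u is treated infinitely often in both ways.

Every block occurs in the subshift, which gives the lower bound. Conversely, a factor of length at
most 2^k lies in two adjacent blocks of level k, one of them a head. There are 2^{k+1} offsets and 2
|C_k| |W_k| = 2 |W_{k+1}| such pairs, which gives n f(n) up to constants. -/

/-! ### Counting occurrences, choosing heads, building the tower -/

section Words

variable {A : Type*} [DecidableEq A]

/-- The number of occurrences of the word `u` at positions of the word `w`. -/
def occ (u : List A) : List A → ℕ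
  | [] => 0
  | a :: l => (if u <+: a :: l then 1 else 0) + occ u l

theorem occ_le_length (u w : List A) : occ u w ≤ w.length := by
  induction w with
  | nil => simp [occ]
  | cons a l ih => simp only [occ, List.length_cons]; split_ifs <;> omega

theorem occ_add_le_occ_append (u v w : List A) : occ u v + occ u w ≤ occ u (v ++ w) := by
  induction v with
  | nil => simp [occ]
  | cons a l ih =>
    simp only [occ, List.cons_append]
    by_cases h : u <+: a :: l
    · have h' : u <+: a :: (l ++ w) := h.trans (List.prefix_append (a :: l) w)
      simp only [h, h', if_true]; omega
    · simp only [h, if_false]; omega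

theorem occ_append_le (u v w : List A) : occ u (v ++ w) ≤ occ u v + occ u w + u.length := by
  -- With the minimum, the error can grow by one per letter of `v` only while `v` is shorter than
  -- `u`, where occurrences may straddle the cut.
  suffices h : occ u (v ++ w) ≤ occ u v + occ u w + min v.length u.length from
    h.trans (by omega)
  induction v with
  | nil => simp [occ]
  | cons a l ih =>
    simp only [occ, List.cons_append, List.length_cons]
    by_cases hl : u.length ≤ l.length + 1
    · have h : u <+: a :: (l ++ w) → u <+: a :: l := fun h =>
        List.prefix_of_prefix_length_le h (List.prefix_append (a :: l) w) (by simpa using hl)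
      split_ifs <;> first | omega | tauto
    · split_ifs <;> omega

/-- A subset of prescribed size, at most half of `W`, on which the oscillation of `g` is at most
half of its oscillation on `W`. -/
theorem exists_subset_card_half_osc {α : Type*} (W : Finset α) (g : α → ℕ) {c : ℕ}
    (hW : W.Nonempty) (hc : 2 * c ≤ W.card + 1) :
    ∃ C ⊆ W, C.card = c ∧
      ∃ w ∈ W, ∃ w' ∈ W, ∀ x ∈ C, ∀ y ∈ C, 2 * g x + g w' ≤ 2 * g y + g w := by
  classical
  obtain ⟨a, ha, hamin⟩ := W.exists_min_image g hW
  obtain ⟨b, hb, hbmax⟩ := W.exists_max_image g hW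
  -- Cut at the midpoint of the minimum and the maximum; one of the two sides holds at least half of
  -- `W`.
  have hunion : W ⊆ W.filter (fun x => 2 * g x ≤ g a + g b) ∪
      W.filter (fun x => g a + g b ≤ 2 * g x) := fun x hx => by
    simp only [Finset.mem_union, Finset.mem_filter, hx, true_and]; omega
  have hcard := (Finset.card_le_card hunion).trans (Finset.card_union_le _ _)
  have hcases : c ≤ (W.filter (fun x => 2 * g x ≤ g a + g b)).card ∨
      c ≤ (W.filter (fun x => g a + g b ≤ 2 * g x)).card := by omega
  rcases hcases with h | h <;> obtain ⟨C, hC, rfl⟩ := Finset.exists_subset_card_eq h <;>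
    refine ⟨C, hC.trans (Finset.filter_subset _ _), rfl, b, hb, a, ha, fun x hx y hy => ?_⟩ <;>
    have hx := Finset.mem_filter.1 (hC hx) <;> have hy := Finset.mem_filter.1 (hC hy) <;>
    have := hamin y hy.1 <;> have := hbmax x hx.1 <;> omega

theorem exists_subset_card_subset_or_superset {α : Type*} (W G : Finset α) (hG : G ⊆ W) {c : ℕ}
    (hc : c ≤ W.card) : ∃ C ⊆ W, C.card = c ∧ (C ⊆ G ∨ G ⊆ C) := by
  rcases le_total c G.card with h | h
  · obtain ⟨C, hC, hcard⟩ := Finset.exists_subset_card_eq h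
    exact ⟨C, hC.trans hG, hcard, Or.inl hC⟩
  · obtain ⟨C, hGC, hCW, hcard⟩ := Finset.exists_subsuperset_card_eq hG h hc
    exact ⟨C, hCW, hcard, Or.inr hGC⟩

/-- Sets of blocks of length `2 ^ k`, where each block of the next level is a block preceded by
a block from a distinguished set of heads. -/
structure BlockTower (A : Type*) [DecidableEq A] where
  /-- The blocks of length `2 ^ k`. -/
  blocks : ℕ → Finset (List A)
  /-- The blocks that may be put in front of another block of the same level. -/
  heads : ℕ → Finset (List A)
  length_eq : ∀ k, ∀ w ∈ blocks k, w.length = 2 ^ k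
  heads_subset : ∀ k, heads k ⊆ blocks k
  heads_nonempty : ∀ k, (heads k).Nonempty
  blocks_succ : ∀ k, blocks (k + 1) = Finset.image₂ (· ++ ·) (heads k) (blocks k)

theorem card_image₂_append {C W : Finset (List A)} {n : ℕ} (hC : ∀ w ∈ C, w.length = n) :
    (Finset.image₂ (· ++ ·) C W).card = C.card * W.card := by
  refine Finset.card_image₂_iff.2 ?_
  rintro ⟨a, b⟩ hab ⟨a', b'⟩ hab' h
  have ha := hC a hab.1
  have ha' := hC a' hab'.1
  obtain ⟨h₁, h₂⟩ := List.append_inj h (ha.trans ha'.symm)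
  exact Prod.ext h₁ h₂

/-- On infinitely many levels, the heads see at most half of the oscillation of the number of
occurrences of any given word. -/
def BlockTower.Balancing (T : BlockTower A) : Prop :=
  ∀ (u : List A) (N : ℕ), ∃ k ≥ N, ∃ w ∈ T.blocks k, ∃ w' ∈ T.blocks k,
    ∀ x ∈ T.heads k, ∀ y ∈ T.heads k, 2 * occ u x + occ u w' ≤ 2 * occ u y + occ u w

/-- On infinitely many levels, the heads are chosen with preference for the blocks that contain
a given word. -/
def BlockTower.Spreading (T : BlockTower A) : Prop :=
  ∀ (u : List A) (N : ℕ), ∃ k ≥ N,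
    T.heads k ⊆ (T.blocks k).filter (u <:+: ·) ∨ (T.blocks k).filter (u <:+: ·) ⊆ T.heads k

/-- A sequence taking each value infinitely often. -/
theorem exists_seq_frequently (α : Type*) [Encodable α] [Inhabited α] :
    ∃ s : ℕ → α, ∀ a N, ∃ k ≥ N, s k = a :=
  ⟨fun k => (Encodable.decode k.unpair.1).getD default, fun a N =>
    ⟨Nat.pair (Encodable.encode a) N, Nat.right_le_pair _ _, by simp⟩⟩

/-- Here `g` and `h` stand for the values of `F` at two consecutive levels, `m` for the number of
blocks and `c` for the number of heads, taken as ⌈2h/m⌉. Since h ≤ g² and 2g ≤ m, one gets 2h ≤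
m²/2, so `c` is at most about half of `m`. If m > 2h then c = 1, and m ≤ 4g ≤ 4h suffices. -/
theorem exists_heads_card {g h m : ℕ} (hg : 0 < g) (hgh : g ≤ h) (hh : h ≤ g * g)
    (hm : 2 * g ≤ m) (hm' : m ≤ 4 * g) :
    ∃ c, 0 < c ∧ 2 * c ≤ m + 1 ∧ 2 * h ≤ c * m ∧ c * m ≤ 4 * h := by
  have hm0 : 0 < m := by omega
  refine ⟨(2 * h + (m - 1)) / m, ?_, ?_, ?_, ?_⟩
  · exact Nat.div_pos (by omega) hm0
  · have : (2 * h + (m - 1)) / m * m ≤ 2 * h + (m - 1) := Nat.div_mul_le_self _ _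
    set c := (2 * h + (m - 1)) / m
    by_contra! hcon
    have h1 : 2 * c * m ≥ (m + 2) * m := Nat.mul_le_mul_right _ hcon
    have h2 : (2 * g) * (2 * g) ≤ m * m := Nat.mul_le_mul hm hm
    have h3 : 2 * c * m = 2 * (c * m) := by ring
    have h4 : (m + 2) * m = m * m + 2 * m := by ring
    have h5 : (2 * g) * (2 * g) = 4 * (g * g) := by ring
    omega
  · have := Nat.div_add_mod (2 * h + (m - 1)) m
    have := Nat.mod_lt (2 * h + (m - 1)) hm0
    have := mul_comm ((2 * h + (m - 1)) / m) m
    omega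
  · have : (2 * h + (m - 1)) / m * m ≤ 2 * h + (m - 1) := Nat.div_mul_le_self _ _
    by_cases hmh : m ≤ 2 * h
    · omega
    · have : (2 * h + (m - 1)) / m ≤ 1 := by
        rw [Nat.div_le_iff_le_mul_add_pred hm0]; omega
      have : (2 * h + (m - 1)) / m * m ≤ 1 * m := Nat.mul_le_mul_right _ this
      omega

theorem exists_blockTower [Fintype A] [Encodable A] {F : ℕ → ℕ} (hpos : ∀ k, 0 < F k)
    (hmono : ∀ k, F k ≤ F (k + 1)) (hsub : ∀ k, F (k + 1) ≤ F k * F k)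
    (hA : Fintype.card A = 2 * F 0) :
    ∃ T : BlockTower A, (∀ k, 2 * F k ≤ (T.blocks k).card) ∧ (∀ k, (T.blocks k).card ≤ 4 * F k) ∧
      (∀ k, 2 * (T.heads k).card ≤ (T.blocks k).card + 1) ∧ T.Balancing ∧ T.Spreading := by
  -- The schedule: at level `k` the word in `s k` is balanced if the flag is `true` and spread if it
  -- is `false`.
  obtain ⟨s, hs⟩ := exists_seq_frequently (List A × Bool)
  let Good : ℕ → Finset (List A) → Prop := fun k W =>
    (∀ w ∈ W, w.length = 2 ^ k) ∧ 2 * F k ≤ W.card ∧ W.card ≤ 4 * F k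
  let Sel : ℕ → Finset (List A) → Finset (List A) → Prop := fun k W C =>
    C ⊆ W ∧ C.Nonempty ∧ 2 * C.card ≤ W.card + 1 ∧
    (∀ u, s k = (u, true) → ∃ w ∈ W, ∃ w' ∈ W,
      ∀ x ∈ C, ∀ y ∈ C, 2 * occ u x + occ u w' ≤ 2 * occ u y + occ u w) ∧
    (∀ u, s k = (u, false) → (C ⊆ W.filter (u <:+: ·) ∨ W.filter (u <:+: ·) ⊆ C))
  have step : ∀ k W, Good k W → ∃ C, Sel k W C ∧ Good (k + 1) (Finset.image₂ (· ++ ·) C W) := by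
    rintro k W ⟨hlen, h2, h4⟩
    obtain ⟨c, hc0, hc, hcl, hcu⟩ := exists_heads_card (hpos k) (hmono k) (hsub k) h2 h4
    have hWc : 0 < W.card := by have := hpos k; omega
    have hWne : W.Nonempty := Finset.card_pos.1 hWc
    have key : ∃ C ⊆ W, C.card = c ∧ (∀ u, s k = (u, true) → ∃ w ∈ W, ∃ w' ∈ W,
        ∀ x ∈ C, ∀ y ∈ C, 2 * occ u x + occ u w' ≤ 2 * occ u y + occ u w) ∧
        (∀ u, s k = (u, false) → (C ⊆ W.filter (u <:+: ·) ∨ W.filter (u <:+: ·) ⊆ C)) := by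
      rcases hk : s k with ⟨u, _ | _⟩
      · obtain ⟨C, hCW, hCc, hC⟩ := exists_subset_card_subset_or_superset W
          (W.filter (u <:+: ·)) (Finset.filter_subset _ _) (c := c) (by omega)
        refine ⟨C, hCW, hCc, by simp, fun v hv => ?_⟩
        obtain rfl : u = v := by simpa using hv
        exact hC
      · obtain ⟨C, hCW, hCc, hC⟩ := exists_subset_card_half_osc W (occ u) hWne hc
        refine ⟨C, hCW, hCc, fun v hv => ?_, by simp⟩
        obtain rfl : u = v := by simpa using hv
        exact hC
    obtain ⟨C, hCW, hCc, hC1, hC2⟩ := key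
    have hCl : ∀ w ∈ C, w.length = 2 ^ k := fun w hw => hlen w (hCW hw)
    refine ⟨C, ⟨hCW, Finset.card_pos.1 (hCc ▸ hc0), hCc ▸ hc, hC1, hC2⟩, ?_, ?_, ?_⟩
    · intro w hw
      obtain ⟨a, ha, b, hb, rfl⟩ := Finset.mem_image₂.1 hw
      simp [hCl a ha, hlen b hb, pow_succ, mul_two]
    · rwa [card_image₂_append hCl, hCc]
    · rwa [card_image₂_append hCl, hCc]
  choose! sel hsel hgood using step
  let W : ℕ → Finset (List A) := fun k => Nat.rec (Finset.univ.image (fun a : A => [a]))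
    (fun k V => Finset.image₂ (· ++ ·) (sel k V) V) k
  have hW : ∀ k, Good k (W k) := by
    intro k
    induction k with
    | zero =>
      have hcard : (W 0).card = 2 * F 0 := by
        rw [← hA]
        exact Finset.card_image_of_injective _ (fun a b h => by simpa using h)
      refine ⟨fun w hw => ?_, hcard.ge, by omega⟩
      obtain ⟨a, -, rfl⟩ := Finset.mem_image.1 hw
      rfl
    | succ k ih => exact hgood k _ ih
  refine ⟨⟨W, fun k => sel k (W k), fun k => (hW k).1, fun k => (hsel k _ (hW k)).1,
    fun k => (hsel k _ (hW k)).2.1, fun k => rfl⟩, fun k => (hW k).2.1, fun k => (hW k).2.2,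
    fun k => (hsel k _ (hW k)).2.2.1, fun u N => ?_, fun u N => ?_⟩
  · obtain ⟨k, hk, hsk⟩ := hs (u, true) N
    exact ⟨k, hk, (hsel k _ (hW k)).2.2.2.1 u hsk⟩
  · obtain ⟨k, hk, hsk⟩ := hs (u, false) N
    exact ⟨k, hk, (hsel k _ (hW k)).2.2.2.2 u hsk⟩

end Words

/-! ### The language of a tower -/

namespace BlockTower

variable {A : Type*} [DecidableEq A] (T : BlockTower A)

theorem blocks_nonempty (k : ℕ) : (T.blocks k).Nonempty :=
  (T.heads_nonempty k).mono (T.heads_subset k)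

theorem mem_blocks_succ {k : ℕ} {w : List A} :
    w ∈ T.blocks (k + 1) ↔ ∃ c ∈ T.heads k, ∃ v ∈ T.blocks k, c ++ v = w := by
  rw [T.blocks_succ, Finset.mem_image₂]

theorem card_blocks_succ (k : ℕ) :
    (T.blocks (k + 1)).card = (T.heads k).card * (T.blocks k).card := by
  rw [T.blocks_succ, card_image₂_append fun w hw => T.length_eq k w (T.heads_subset k hw)]

/-- The words that are factors of some block. -/
def language : Set (List A) := {u | ∃ k, ∃ w ∈ T.blocks k, u <:+: w}

variable {T}

theorem language_of_infix {u v : List A} (hv : v ∈ T.language) (h : u <:+: v) :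
    u ∈ T.language := by
  obtain ⟨k, w, hw, hvw⟩ := hv
  exact ⟨k, w, hw, h.trans hvw⟩

theorem exists_suffix_of_le {k K : ℕ} (hkK : k ≤ K) :
    ∀ w ∈ T.blocks K, ∃ v ∈ T.blocks k, v <:+ w := by
  induction K, hkK using Nat.le_induction with
  | base => exact fun w hw => ⟨w, hw, List.suffix_rfl⟩
  | succ K _ ih =>
    intro w hw
    obtain ⟨c, _, v, hv, rfl⟩ := T.mem_blocks_succ.1 hw
    obtain ⟨v', hv', h⟩ := ih v hv
    exact ⟨v', hv', h.trans (List.suffix_append _ _)⟩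

/-- Unlike the last sub-block, the first one is always a head; the complexity bound rests on this
asymmetry. -/
theorem exists_prefix_of_lt {k K : ℕ} (hkK : k < K) :
    ∀ w ∈ T.blocks K, ∃ c ∈ T.heads k, c <+: w := by
  induction K, hkK using Nat.le_induction with
  | base =>
    intro w hw
    obtain ⟨c, hc, v, _, rfl⟩ := T.mem_blocks_succ.1 hw
    exact ⟨c, hc, List.prefix_append _ _⟩
  | succ K _ ih =>
    intro w hw
    obtain ⟨c, hc, v, hv, rfl⟩ := T.mem_blocks_succ.1 hw
    obtain ⟨c', hc', h⟩ := ih c (T.heads_subset K hc)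
    exact ⟨c', hc', h.trans (List.prefix_append _ _)⟩

theorem exists_block_infix_of_le {k K : ℕ} (hkK : k ≤ K) :
    ∀ w ∈ T.blocks k, ∃ v ∈ T.blocks K, w <:+: v := by
  induction K, hkK using Nat.le_induction with
  | base => exact fun w hw => ⟨w, hw, List.infix_rfl⟩
  | succ K _ ih =>
    intro w hw
    obtain ⟨v, hv, h⟩ := ih w hw
    obtain ⟨c, hc⟩ := T.heads_nonempty K
    exact ⟨c ++ v, T.mem_blocks_succ.2 ⟨c, hc, v, hv, rfl⟩,
      h.trans (List.suffix_append _ _).isInfix⟩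

theorem exists_block_of_mem_language {u : List A} (hu : u ∈ T.language) (k : ℕ) :
    ∃ K, k ≤ K ∧ ∃ w ∈ T.blocks K, u <:+: w := by
  obtain ⟨j, w, hw, huw⟩ := hu
  obtain ⟨v, hv, h⟩ := exists_block_infix_of_le (le_max_right k j) w hw
  exact ⟨_, le_max_left k j, v, hv, huw.trans h⟩

/-- A factor of a concatenation is a factor of one of the two words, or straddles them. -/
theorem _root_.List.IsInfix.append_cases {α : Type*} {u v w : List α} (h : u <:+: v ++ w) :
    u <:+: v ∨ u <:+: w ∨ ∃ s p, u = s ++ p ∧ s <:+ v ∧ p <+: w := by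
  obtain ⟨a, b, hab⟩ := h
  rw [List.append_assoc] at hab
  rcases List.append_eq_append_iff.1 hab with ⟨s, rfl, hs⟩ | ⟨s, rfl, hs⟩
  · rcases List.append_eq_append_iff.1 hs with ⟨p, rfl, hp⟩ | ⟨p, rfl, hp⟩
    · exact Or.inl ⟨a, p, by simp⟩
    · exact Or.inr (Or.inr ⟨s, p, rfl, List.suffix_append _ _, hp ▸ List.prefix_append _ _⟩)
  · exact Or.inr (Or.inl ⟨s, b, by simp [hs]⟩)

theorem _root_.List.IsPrefix.append_cases {α : Type*} {u v w : List α} (h : u <+: v ++ w) :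
    u <+: v ∨ ∃ p, v ++ p = u ∧ p <+: w := by
  obtain ⟨b, hb⟩ := h
  rcases List.append_eq_append_iff.1 hb with ⟨s, rfl, hs⟩ | ⟨s, rfl, hs⟩
  · exact Or.inl (List.prefix_append _ _)
  · exact Or.inr ⟨s, rfl, hs ▸ List.prefix_append _ _⟩

theorem _root_.List.IsSuffix.append_cases {α : Type*} {u v w : List α} (h : u <:+ v ++ w) :
    u <:+ w ∨ ∃ s, s ++ w = u ∧ s <:+ v := by
  obtain ⟨b, hb⟩ := h
  rcases List.append_eq_append_iff.1 hb with ⟨s, rfl, hs⟩ | ⟨s, rfl, hs⟩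
  · exact Or.inr ⟨s, hs.symm, List.suffix_append _ _⟩
  · exact Or.inl (hs ▸ List.suffix_append _ _)

/-- Short words of the language appear in a pair of consecutive blocks, one of which is a head. -/
theorem infix_head_block_of_mem_language {u : List A} (hu : u ∈ T.language) {k : ℕ}
    (hk : u.length ≤ 2 ^ k) :
    ∃ c ∈ T.heads k, ∃ w ∈ T.blocks k, u <:+: c ++ w ∨ u <:+: w ++ c := by
  obtain ⟨K, hK, v, hv, huv⟩ := exists_block_of_mem_language hu (k + 1)
  induction K, hK using Nat.le_induction generalizing v with
  | base =>
    obtain ⟨c, hc, w, hw, rfl⟩ := T.mem_blocks_succ.1 hv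
    exact ⟨c, hc, w, hw, Or.inl huv⟩
  | succ K hK ih =>
    obtain ⟨c, hc, w, hw, rfl⟩ := T.mem_blocks_succ.1 hv
    rcases huv.append_cases with h | h | ⟨s, p, rfl, hs, hp⟩
    · exact ih c (T.heads_subset K hc) h
    · exact ih w hw h
    -- The junction of two larger blocks shows a level-`k` block followed by a head, hence the
    -- reversed order in the conclusion.
    · obtain ⟨w', hw', hw'c⟩ := exists_suffix_of_le (by omega : k ≤ K) c (T.heads_subset K hc)
      obtain ⟨c', hc', hc'w⟩ := exists_prefix_of_lt (by omega : k < K) w hw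
      rw [List.length_append] at hk
      have h1 : s <:+ w' := List.suffix_of_suffix_length_le hs hw'c
        (by rw [T.length_eq k w' hw']; omega)
      have h2 : p <+: c' := List.prefix_of_prefix_length_le hp hc'w
        (by rw [T.length_eq k c' (T.heads_subset k hc')]; omega)
      refine ⟨c', hc', w', hw', Or.inr ?_⟩
      obtain ⟨s', rfl⟩ := h1
      obtain ⟨p', rfl⟩ := h2
      exact ⟨s', p', by simp⟩

/-- Long words of the language contain a block. -/
theorem exists_block_infix_of_mem_language {u : List A} (hu : u ∈ T.language) {k : ℕ}
    (hk : 2 * 2 ^ k ≤ u.length) : ∃ w ∈ T.blocks k, w <:+: u := by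
  obtain ⟨K, hK, v, hv, huv⟩ := exists_block_of_mem_language hu (k + 1)
  induction K, hK using Nat.le_induction generalizing v with
  | base =>
    obtain rfl : u = v := huv.eq_of_length_le (by rw [T.length_eq _ v hv, pow_succ]; omega)
    obtain ⟨c, hc, w, hw, rfl⟩ := T.mem_blocks_succ.1 hv
    exact ⟨w, hw, (List.suffix_append _ _).isInfix⟩
  | succ K hK ih =>
    obtain ⟨c, hc, w, hw, rfl⟩ := T.mem_blocks_succ.1 hv
    rcases huv.append_cases with h | h | ⟨s, p, rfl, hs, hp⟩
    · exact ih c (T.heads_subset K hc) h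
    · exact ih w hw h
    · rw [List.length_append] at hk
      rcases le_total (2 ^ k) s.length with h | h
      · obtain ⟨w', hw', hw'c⟩ := exists_suffix_of_le (by omega : k ≤ K) c (T.heads_subset K hc)
        refine ⟨w', hw', (List.suffix_of_suffix_length_le hw'c hs ?_).isInfix.trans
          (List.prefix_append _ _).isInfix⟩
        rwa [T.length_eq k w' hw']
      · obtain ⟨c', hc', hc'w⟩ := exists_prefix_of_lt (by omega : k < K) w hw
        refine ⟨c', T.heads_subset k hc', (List.prefix_of_prefix_length_le hc'w hp ?_).isInfix.trans
          (List.suffix_append _ _).isInfix⟩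
        rw [T.length_eq k c' (T.heads_subset k hc')]; omega

/-- A subadditive function that is nonpositive on the blocks of some level is bounded above on
the whole language. -/
theorem subadditive_le_of_mem_language {F : List A → ℝ} (hF : ∀ v w, F (v ++ w) ≤ F v + F w)
    {k : ℕ} (hk : ∀ w ∈ T.blocks k, F w ≤ 0) {B : ℝ} (hB0 : 0 ≤ B)
    (hB : ∀ w, w.length ≤ 2 ^ k → F w ≤ B) {u : List A} (hu : u ∈ T.language) :
    F u ≤ 2 * B := by
  have hblock : ∀ K ≥ k, ∀ w ∈ T.blocks K, F w ≤ 0 := by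
    intro K hK
    induction K, hK using Nat.le_induction with
    | base => exact hk
    | succ K hK ih =>
      intro v hv
      obtain ⟨c, hc, w, hw, rfl⟩ := T.mem_blocks_succ.1 hv
      linarith [hF c w, ih c (T.heads_subset K hc), ih w hw]
  -- A suffix of a block splits into a short piece and whole blocks; the latter contribute at most
  -- 0, so the bound does not depend on `K`.
  have hsuff : ∀ K ≥ k, ∀ w ∈ T.blocks K, ∀ s, s <:+ w → F s ≤ B := by
    intro K hK
    induction K, hK using Nat.le_induction with
    | base => exact fun w hw s hs => hB s (hs.length_le.trans (T.length_eq k w hw).le)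
    | succ K hK ih =>
      intro v hv s hs
      obtain ⟨c, hc, w, hw, rfl⟩ := T.mem_blocks_succ.1 hv
      rcases hs.append_cases with h | ⟨s', rfl, hs'⟩
      · exact ih w hw s h
      · linarith [hF s' w, ih c (T.heads_subset K hc) s' hs', hblock K hK w hw]
  have hpref : ∀ K ≥ k, ∀ w ∈ T.blocks K, ∀ s, s <+: w → F s ≤ B := by
    intro K hK
    induction K, hK using Nat.le_induction with
    | base => exact fun w hw s hs => hB s (hs.length_le.trans (T.length_eq k w hw).le)
    | succ K hK ih =>
      intro v hv s hs
      obtain ⟨c, hc, w, hw, rfl⟩ := T.mem_blocks_succ.1 hv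
      rcases hs.append_cases with h | ⟨s', rfl, hs'⟩
      · exact ih c (T.heads_subset K hc) s h
      · linarith [hF c s', ih w hw s' hs', hblock K hK c (T.heads_subset K hc)]
  obtain ⟨K, hK, v, hv, huv⟩ := exists_block_of_mem_language hu k
  induction K, hK using Nat.le_induction generalizing v with
  | base => linarith [hB u (huv.length_le.trans (T.length_eq k v hv).le)]
  | succ K hK ih =>
    obtain ⟨c, hc, w, hw, rfl⟩ := T.mem_blocks_succ.1 hv
    rcases huv.append_cases with h | h | ⟨s, p, rfl, hs, hp⟩
    · exact ih c (T.heads_subset K hc) h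
    · exact ih w hw h
    · linarith [hF s p, hsuff K hK c (T.heads_subset K hc) s hs, hpref K hK w hw p hp]

/-! ### Balancing: uniform frequencies -/

/-- The oscillation of the number of occurrences of `u` over blocks of level `k`, corrected by
the length of `u`, is at most `δ * 2 ^ k`. -/
def OscLE (T : BlockTower A) (u : List A) (k : ℕ) (δ : ℝ) : Prop :=
  ∀ w ∈ T.blocks k, ∀ w' ∈ T.blocks k, (occ u w : ℝ) - occ u w' + u.length ≤ δ * 2 ^ k

/-- Concatenation costs one extra `u.length`; with the correction term included, the quantity at
most doubles, as does 2^k. -/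
theorem OscLE.succ {u : List A} {k : ℕ} {δ : ℝ} (h : T.OscLE u k δ) : T.OscLE u (k + 1) δ := by
  intro w hw w' hw'
  obtain ⟨c, hc, v, hv, rfl⟩ := T.mem_blocks_succ.1 hw
  obtain ⟨c', hc', v', hv', rfl⟩ := T.mem_blocks_succ.1 hw'
  have h1 : (occ u (c ++ v) : ℝ) ≤ occ u c + occ u v + u.length := mod_cast occ_append_le u c v
  have h2 : (occ u c' + occ u v' : ℝ) ≤ occ u (c' ++ v') := mod_cast occ_add_le_occ_append u c' v'
  have h3 := h c (T.heads_subset k hc) c' (T.heads_subset k hc')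
  have h4 := h v hv v' hv'
  rw [pow_succ]; linarith

theorem OscLE.mono {u : List A} {k K : ℕ} {δ : ℝ} (h : T.OscLE u k δ) (hK : k ≤ K) :
    T.OscLE u K δ := by
  induction K, hK using Nat.le_induction with
  | base => exact h
  | succ K _ ih => exact ih.succ

theorem Balancing.exists_oscLE (hT : T.Balancing) (u : List A) {ε : ℝ} (hε : 0 < ε) :
    ∃ k, T.OscLE u k ε := by
  -- With D = δ 2^k, the heads contribute (D - |u|)/2 and the tails D - |u|. Adding |u| for the cut
  -- and |u| for the correction gives 3D/2 + |u|/2 ≤ 7D/4 once 2|u| ≤ D, and 7D/4 = (7/8) δ 2^{k+1}.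
  have step : ∀ δ > 0, (∃ k, T.OscLE u k δ) → ∃ k, T.OscLE u k (7 / 8 * δ) := by
    rintro δ hδ ⟨k₀, hk₀⟩
    obtain ⟨N, hN⟩ := pow_unbounded_of_one_lt (u.length / δ * 2) (one_lt_two (α := ℝ))
    obtain ⟨k, hk, w₀, hw₀, w₁, hw₁, hh⟩ := hT u (max k₀ N)
    have hosc := hk₀.mono (le_of_max_le_left hk)
    have hlen : (u.length : ℝ) * 2 ≤ δ * 2 ^ k := by
      have h1 : (2 : ℝ) ^ N ≤ 2 ^ k := pow_le_pow_right₀ one_le_two (le_of_max_le_right hk)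
      have h2 : u.length / δ * 2 ≤ (2 : ℝ) ^ k := hN.le.trans h1
      rw [div_mul_eq_mul_div, div_le_iff₀ hδ] at h2
      linarith
    refine ⟨k + 1, ?_⟩
    intro w hw w' hw'
    obtain ⟨c, hc, v, hv, rfl⟩ := T.mem_blocks_succ.1 hw
    obtain ⟨c', hc', v', hv', rfl⟩ := T.mem_blocks_succ.1 hw'
    have h1 : (occ u (c ++ v) : ℝ) ≤ occ u c + occ u v + u.length := mod_cast occ_append_le u c v
    have h2 : (occ u c' + occ u v' : ℝ) ≤ occ u (c' ++ v') :=
      mod_cast occ_add_le_occ_append u c' v'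
    have h3 : (2 * occ u c + occ u w₁ : ℝ) ≤ 2 * occ u c' + occ u w₀ := mod_cast hh c hc c' hc'
    have h4 := hosc v hv v' hv'
    have h5 := hosc w₀ hw₀ w₁ hw₁
    rw [pow_succ]; linarith
  have iter : ∀ n : ℕ, ∃ k, T.OscLE u k ((7 / 8) ^ n * (1 + u.length)) := by
    intro n
    induction n with
    | zero =>
      refine ⟨0, fun w hw w' _ => ?_⟩
      have h1 : (occ u w : ℝ) ≤ 1 := by
        have := (occ_le_length u w).trans (T.length_eq 0 w hw).le
        exact_mod_cast this
      have h2 : (0 : ℝ) ≤ occ u w' := Nat.cast_nonneg _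
      simp only [pow_zero, one_mul, mul_one]; linarith
    | succ n ih =>
      have := step _ (by positivity) ih
      rwa [← mul_assoc, ← pow_succ'] at this
  obtain ⟨n, hn⟩ := exists_pow_lt_of_lt_one (show 0 < ε / (1 + u.length) by positivity)
    (show (7 / 8 : ℝ) < 1 by norm_num)
  obtain ⟨k, hk⟩ := iter n
  refine ⟨k, fun w hw w' hw' => (hk w hw w' hw').trans ?_⟩
  rw [lt_div_iff₀ (by positivity)] at hn
  gcongr

/-- Uniform frequencies: the number of occurrences of `u` in a word of the language is
nearly proportional to the length of the word. -/
theorem Balancing.exists_frequency (hT : T.Balancing) (u : List A) {ε : ℝ} (hε : 0 < ε) :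
    ∃ α B : ℝ, ∀ y ∈ T.language,
      (α - ε) * y.length - B ≤ occ u y ∧ (occ u y : ℝ) ≤ (α + ε) * y.length + B := by
  obtain ⟨k, hk⟩ := hT.exists_oscLE u hε
  obtain ⟨w₀, hw₀⟩ := T.blocks_nonempty k
  have hpow : (0 : ℝ) < 2 ^ k := by positivity
  have hlen : ∀ w ∈ T.blocks k, (w.length : ℝ) = 2 ^ k := fun w hw => by
    rw [T.length_eq k w hw]; push_cast; rfl
  have hocc : ∀ w, (occ u w : ℝ) ≤ w.length := fun w => mod_cast occ_le_length u w
  set α : ℝ := occ u w₀ / 2 ^ k with hα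
  have hα0 : 0 ≤ α := by positivity
  have hα1 : α ≤ 1 := by
    rw [hα, div_le_one hpow, ← hlen w₀ hw₀]; exact hocc w₀
  have hαk : α * 2 ^ k = occ u w₀ := by rw [hα]; field_simp
  -- Both deviations, (α - ε)|y| - occ and occ + |u| - (α + ε)|y|, are subadditive and nonpositive
  -- on level-`k` blocks, so `subadditive_le_of_mem_language` applies.
  refine ⟨α, 2 * (2 ^ k + u.length), fun y hy => ⟨?_, ?_⟩⟩
  · have := subadditive_le_of_mem_language (T := T) (F := fun y => (α - ε) * y.length - occ u y)
      (k := k) (B := 2 ^ k) (fun v w => ?_) (fun w hw => ?_) hpow.le (fun w hw => ?_) hy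
    · have : (0 : ℝ) ≤ u.length := Nat.cast_nonneg _
      linarith
    · have : (occ u v + occ u w : ℝ) ≤ occ u (v ++ w) := mod_cast occ_add_le_occ_append u v w
      simp only [List.length_append, Nat.cast_add]; linarith
    · have h1 := hk w₀ hw₀ w hw
      have : (0 : ℝ) ≤ u.length := Nat.cast_nonneg _
      simp only [hlen w hw]; linarith
    · have h1 : (w.length : ℝ) ≤ 2 ^ k := mod_cast hw
      have h2 : (α - ε) * w.length ≤ 1 * w.length := by gcongr; linarith
      have : (0 : ℝ) ≤ occ u w := Nat.cast_nonneg _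
      linarith
  · have := subadditive_le_of_mem_language (T := T)
      (F := fun y => occ u y + u.length - (α + ε) * y.length)
      (k := k) (B := 2 ^ k + u.length) (fun v w => ?_) (fun w hw => ?_) (by positivity)
      (fun w hw => ?_) hy
    · have : (0 : ℝ) ≤ u.length := Nat.cast_nonneg _
      linarith
    · have : (occ u (v ++ w) : ℝ) ≤ occ u v + occ u w + u.length := mod_cast occ_append_le u v w
      simp only [List.length_append, Nat.cast_add]; linarith
    · have h1 := hk w hw w₀ hw₀
      simp only [hlen w hw]; linarith
    · have h1 : (w.length : ℝ) ≤ 2 ^ k := mod_cast hw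
      have h2 : 0 ≤ (α + ε) * w.length := by positivity
      linarith [hocc w]

/-! ### Spreading: each word enters all blocks of some level -/

/-- The blocks of level `k` that do not contain the word `u`. -/
def avoiding (T : BlockTower A) (u : List A) (k : ℕ) : Finset (List A) :=
  (T.blocks k).filter (¬ u <:+: ·)

theorem avoiding_succ_subset (u : List A) (k : ℕ) : T.avoiding u (k + 1) ⊆
    Finset.image₂ (· ++ ·) ((T.heads k).filter (¬ u <:+: ·)) (T.avoiding u k) := by
  intro w hw
  obtain ⟨hw, hu⟩ := Finset.mem_filter.1 hw
  obtain ⟨c, hc, v, hv, rfl⟩ := T.mem_blocks_succ.1 hw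
  exact Finset.mem_image₂.2 ⟨c,
    Finset.mem_filter.2 ⟨hc, fun h => hu (h.trans (List.prefix_append _ _).isInfix)⟩, v,
    Finset.mem_filter.2 ⟨hv, fun h => hu (h.trans (List.suffix_append _ _).isInfix)⟩, rfl⟩

theorem card_avoiding_succ_le (u : List A) (k : ℕ) : (T.avoiding u (k + 1)).card ≤
    ((T.heads k).filter (¬ u <:+: ·)).card * (T.avoiding u k).card :=
  (Finset.card_le_card (avoiding_succ_subset u k)).trans (Finset.card_image₂_le _ _ _)

/-- The proportion of blocks of level `k` avoiding `u` is at most `r`. -/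
def AvoidLE (T : BlockTower A) (u : List A) (k : ℕ) (r : ℝ) : Prop :=
  ((T.avoiding u k).card : ℝ) ≤ r * (T.blocks k).card

theorem AvoidLE.succ {u : List A} {k : ℕ} {r : ℝ} (h : T.AvoidLE u k r) :
    T.AvoidLE u (k + 1) r := by
  have h1 : ((T.avoiding u (k + 1)).card : ℝ) ≤ (T.heads k).card * (T.avoiding u k).card := by
    exact_mod_cast (card_avoiding_succ_le u k).trans
      (Nat.mul_le_mul_right _ (Finset.card_filter_le _ _))
  have h2 : ((T.heads k).card : ℝ) * (T.avoiding u k).card ≤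
      (T.heads k).card * (r * (T.blocks k).card) := by gcongr; exact h
  unfold AvoidLE
  rw [T.card_blocks_succ]; push_cast; linarith

theorem AvoidLE.mono {u : List A} {k K : ℕ} {r : ℝ} (h : T.AvoidLE u k r) (hK : k ≤ K) :
    T.AvoidLE u K r := by
  induction K, hK using Nat.le_induction with
  | base => exact h
  | succ K _ ih => exact ih.succ

theorem infix_of_heads_contain {u : List A} {k K : ℕ}
    (h : T.heads k ⊆ (T.blocks k).filter (u <:+: ·)) (hK : k < K) :
    ∀ w ∈ T.blocks K, u <:+: w := by
  intro w hw
  obtain ⟨c, hc, hcw⟩ := exists_prefix_of_lt hK w hw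
  exact (Finset.mem_filter.1 (h hc)).2.trans hcw.isInfix

/-- In a spreading tower, each word of the language appears in all blocks of high level. -/
theorem Spreading.exists_forall_infix (hT : T.Spreading)
    (hcard : ∀ k, 2 * (T.heads k).card ≤ (T.blocks k).card + 1)
    (htwo : ∀ k, 2 ≤ (T.blocks k).card)
    {u : List A} (hu : u ∈ T.language) : ∃ k, ∀ w ∈ T.blocks k, u <:+: w := by
  by_contra! hcon
  -- If all heads of a level contained `u`, so would all higher blocks, since they begin with a
  -- head. Hence the other alternative holds infinitely often.
  have hsub : ∀ N, ∃ k ≥ N, (T.blocks k).filter (u <:+: ·) ⊆ T.heads k := by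
    intro N
    obtain ⟨k, hk, h | h⟩ := hT u N
    · obtain ⟨w, hw, hn⟩ := hcon (k + 1)
      exact absurd (infix_of_heads_contain h (Nat.lt_succ_self k) w hw) hn
    · exact ⟨k, hk, h⟩
  have hsplit : ∀ k, (((T.blocks k).filter (u <:+: ·)).card : ℝ) + (T.avoiding u k).card =
      (T.blocks k).card := fun k => mod_cast Finset.card_filter_add_card_filter_not _
  have hbpos : ∀ k, (0 : ℝ) < (T.blocks k).card := fun k => by
    exact_mod_cast (T.blocks_nonempty k).card_pos
  obtain ⟨k₀, w₀, hw₀, huw₀⟩ := hu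
  set r₀ : ℝ := (T.avoiding u k₀).card / (T.blocks k₀).card with hr₀
  have hr₀0 : 0 ≤ r₀ := by positivity
  have hr₀1 : r₀ < 1 := by
    rw [hr₀, div_lt_one (hbpos k₀), ← hsplit k₀]
    have : 0 < ((T.blocks k₀).filter (u <:+: ·)).card :=
      Finset.card_pos.2 ⟨w₀, Finset.mem_filter.2 ⟨hw₀, huw₀⟩⟩
    have : (0 : ℝ) < ((T.blocks k₀).filter (u <:+: ·)).card := mod_cast this
    linarith
  have hinit : T.AvoidLE u k₀ r₀ := by
    unfold AvoidLE
    rw [hr₀, div_mul_cancel₀ _ (hbpos k₀).ne']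
  have step : ∀ r ≥ 0, (∃ k, T.AvoidLE u k r) → ∃ k, T.AvoidLE u k (r₀ * r) := by
    rintro r hr ⟨k₁, hk₁⟩
    obtain ⟨k, hk, hG⟩ := hsub (max k₀ k₁)
    have h0 := hinit.mono (le_of_max_le_left hk)
    have h1 := hk₁.mono (le_of_max_le_right hk)
    refine ⟨k + 1, ?_⟩
    have hfilter : (T.heads k).filter (u <:+: ·) = (T.blocks k).filter (u <:+: ·) :=
      (Finset.filter_subset_filter _ (T.heads_subset k)).antisymm fun w hw =>
        Finset.mem_filter.2 ⟨hG hw, (Finset.mem_filter.1 hw).2⟩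
    -- The heads include all blocks containing `u`, so avoiding blocks are no more frequent among
    -- them than among all blocks.
    have hbad : (((T.heads k).filter (¬ u <:+: ·)).card : ℝ) ≤ r₀ * (T.heads k).card := by
      have hs : (((T.heads k).filter (u <:+: ·)).card : ℝ) +
        ((T.heads k).filter (¬ u <:+: ·)).card = (T.heads k).card :=
        mod_cast Finset.card_filter_add_card_filter_not _
      rw [hfilter] at hs
      have h2 := hsplit k
      have h3 : ((T.heads k).card : ℝ) ≤ (T.blocks k).card :=
        mod_cast Finset.card_le_card (T.heads_subset k)
      unfold AvoidLE at h0
      nlinarith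
    have h4 : ((T.avoiding u (k + 1)).card : ℝ) ≤
        ((T.heads k).filter (¬ u <:+: ·)).card * (T.avoiding u k).card :=
      mod_cast card_avoiding_succ_le u k
    unfold AvoidLE at h1 ⊢
    rw [T.card_blocks_succ]; push_cast
    calc ((T.avoiding u (k + 1)).card : ℝ)
        ≤ (r₀ * (T.heads k).card) * (r * (T.blocks k).card) :=
          h4.trans (mul_le_mul hbad h1 (by positivity) (by positivity))
      _ = _ := by ring
  have iter : ∀ n : ℕ, ∃ k, T.AvoidLE u k (r₀ ^ n * r₀) := by
    intro n
    induction n with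
    | zero => exact ⟨k₀, by simpa using hinit⟩
    | succ n ih =>
      have := step _ (by positivity) ih
      rwa [← mul_assoc, ← pow_succ'] at this
  -- Eventually more than 3/4 of the blocks contain `u`, yet at a level from `hsub` these are all
  -- heads, at most (m + 1)/2 ≤ 3m/4 of the m ≥ 2 blocks.
  obtain ⟨n, hn⟩ := exists_pow_lt_of_lt_one (show (0 : ℝ) < 1 / 4 by norm_num) hr₀1
  obtain ⟨k₁, hk₁⟩ := iter n
  obtain ⟨k, hk, hG⟩ := hsub k₁
  have h1 := hk₁.mono hk
  have h2 : (((T.blocks k).filter (u <:+: ·)).card : ℝ) ≤ (T.heads k).card :=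
    mod_cast Finset.card_le_card hG
  have h3 : (2 * (T.heads k).card : ℝ) ≤ (T.blocks k).card + 1 := mod_cast hcard k
  have h4 : (2 : ℝ) ≤ (T.blocks k).card := mod_cast htwo k
  have h5 := hsplit k
  have h6 : r₀ ^ n * r₀ < 1 / 4 := by
    have : 0 ≤ r₀ ^ n := by positivity
    nlinarith
  unfold AvoidLE at h1
  nlinarith

end BlockTower

/-! ### Windows of configurations -/

section Windows

variable {A : Type*}

/-- The word of length `n` at position `i` of the configuration `x`. -/
def window (x : ℤ → A) (i : ℤ) (n : ℕ) : List A := List.ofFn fun j : Fin n => x (i + (j : ℕ))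

@[simp]
theorem length_window (x : ℤ → A) (i : ℤ) (n : ℕ) : (window x i n).length = n := by simp [window]

theorem window_succ (x : ℤ → A) (i : ℤ) (n : ℕ) :
    window x i (n + 1) = x i :: window x (i + 1) n := by
  simp only [window, List.ofFn_succ, Fin.val_zero, Nat.cast_zero, add_zero, Fin.val_succ,
    Nat.cast_add, Nat.cast_one]
  congr 2; ext j; congr 1; ring

theorem window_add (x : ℤ → A) (i : ℤ) (m n : ℕ) :
    window x i (m + n) = window x i m ++ window x (i + m) n := by
  induction m generalizing i with
  | zero => simp [window]
  | succ m ih =>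
    rw [show m + 1 + n = (m + n) + 1 by ring, window_succ, ih, window_succ]
    simp only [List.cons_append, Nat.cast_add, Nat.cast_one]
    congr 3; ring

theorem window_infix (x : ℤ → A) {i j : ℤ} {m n : ℕ} (hij : i ≤ j) (h : j + m ≤ i + n) :
    window x j m <:+: window x i n := by
  obtain ⟨a, rfl⟩ := Int.le.dest hij
  obtain ⟨b, rfl⟩ : ∃ b, n = a + m + b := ⟨n - (a + m), by omega⟩
  exact ⟨window x i a, window x (i + (a + m : ℕ)) b, by rw [window_add, window_add]⟩

theorem exists_window_eq_of_infix {x : ℤ → A} {i : ℤ} {n : ℕ} {u : List A}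
    (h : u <:+: window x i n) : ∃ j, window x j u.length = u := by
  obtain ⟨a, b, hab⟩ := h
  have hn : n = a.length + u.length + b.length := by
    rw [← length_window x i n, ← hab]; simp [add_assoc]
  subst hn
  rw [window_add, window_add] at hab
  have h1 := (List.append_inj hab (by simp)).1
  exact ⟨_, ((List.append_inj h1 (by simp)).2).symm⟩

theorem window_eq_window_iff {x y : ℤ → A} {i i' : ℤ} {n : ℕ} :
    window x i n = window y i' n ↔ ∀ j : ℕ, j < n → x (i + j) = y (i' + j) := by
  rw [window, window, List.ofFn_inj, funext_iff, Fin.forall_iff]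

theorem window_shift (x : ℤ → A) (g i : ℤ) (n : ℕ) :
    window (shift g x) i n = window x (g + i) n := by
  simp [window, add_assoc]

theorem exists_window_eq [Nonempty A] (u : List A) (i : ℤ) :
    ∃ x : ℤ → A, window x i u.length = u := by
  classical
  obtain ⟨a⟩ := ‹Nonempty A›
  refine ⟨fun j => u.getD (j - i).toNat a, ?_⟩
  refine List.ext_getElem (by simp) fun j h1 h2 => ?_
  simp [window]

theorem occ_window_le_sum [DecidableEq A] (u : List A) (x : ℤ → A) (i : ℤ) (n : ℕ) :
    occ u (window x i n) ≤
      ∑ j ∈ Finset.range n, if window x (i + j) u.length = u then 1 else 0 := by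
  induction n generalizing i with
  | zero => simp [window, occ]
  | succ n ih =>
    rw [Finset.sum_range_succ', window_succ, occ]
    have hpre : u <+: x i :: window x (i + 1) n →
        window x (i + (0 : ℕ)) u.length = u := by
      intro h
      rw [← window_succ] at h
      have hl := h.length_le
      rw [length_window] at hl
      obtain ⟨b, hb⟩ : ∃ b, n + 1 = u.length + b := ⟨_, (Nat.add_sub_cancel' hl).symm⟩
      rw [hb, window_add] at h
      have := List.prefix_of_prefix_length_le h (List.prefix_append _ _) (by simp)
      simpa using (this.eq_of_length (by simp)).symm
    have := ih (i + 1)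
    have hcongr : ∀ j : ℕ, i + 1 + (j : ℤ) = i + ((j + 1 : ℕ) : ℤ) := fun j => by push_cast; ring
    simp only [hcongr] at this
    split_ifs <;> first | omega | tauto

/-- `occ` only sees occurrences that end inside the window, so the window is lengthened by
`u.length`. -/
theorem sum_le_occ_window [DecidableEq A] (u : List A) (x : ℤ → A) (i : ℤ) (n : ℕ) :
    ∑ j ∈ Finset.range n, (if window x (i + j) u.length = u then 1 else 0) ≤
      occ u (window x i (n + u.length)) := by
  induction n generalizing i with
  | zero => simp
  | succ n ih =>
    rw [Finset.sum_range_succ', show n + 1 + u.length = n + u.length + 1 by ring, window_succ, occ]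
    have hpre : window x (i + (0 : ℕ)) u.length = u →
        u <+: x i :: window x (i + 1) (n + u.length) := by
      intro h
      rw [← window_succ, show n + u.length + 1 = u.length + (n + 1) by ring, window_add]
      simp only [Nat.cast_zero, add_zero] at h
      rw [h]; exact List.prefix_append _ _
    have := ih (i + 1)
    have hcongr : ∀ j : ℕ, i + 1 + (j : ℤ) = i + ((j + 1 : ℕ) : ℤ) := fun j => by push_cast; ring
    simp only [hcongr] at this
    split_ifs <;> first | omega | tauto

theorem continuous_coords [TopologicalSpace A] (i : ℤ) (n : ℕ) :
    Continuous fun (x : ℤ → A) (j : Fin n) => x (i + (j : ℕ)) := by fun_prop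

theorem isClosed_window_mem [TopologicalSpace A] [DiscreteTopology A] [Finite A]
    (i : ℤ) (n : ℕ) (L : Set (List A)) :
    IsClosed {x : ℤ → A | window x i n ∈ L} := by
  have : DiscreteTopology (Fin n → A) := inferInstance
  exact (isClosed_discrete {v : Fin n → A | List.ofFn v ∈ L}).preimage (continuous_coords i n)

theorem finite_factors [Finite A] [TopologicalSpace A] (X : Subshift A ℤ) (n : ℕ) :
    (factors X n).Finite := Set.toFinite _

theorem complexity_mono [Finite A] [TopologicalSpace A] (X : Subshift A ℤ) :
    Monotone (complexity X) := by
  intro m n hmn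
  have : factors X m ⊆ (fun (u : Fin n → A) (j : Fin m) => u (j.castLE hmn)) '' factors X n := by
    rintro u ⟨x, hx, i, hu⟩
    exact ⟨fun j => x (i + (j : ℕ)), ⟨x, hx, i, fun j => rfl⟩, funext fun j => (hu j).symm⟩
  exact (Set.ncard_le_ncard this ((finite_factors X n).image _)).trans
    (Set.ncard_image_le (finite_factors X n))

end Windows

/-! ### The subshift: minimality and complexity -/

namespace BlockTower

variable {A : Type*} [DecidableEq A] [Finite A] [TopologicalSpace A] [DiscreteTopology A]
  {T : BlockTower A}

/-- The subshift of configurations all of whose factors belong to the language of the tower. -/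
def subshift (T : BlockTower A) : Subshift A ℤ where
  carrier := {x | ∀ i n, window x i n ∈ T.language}
  isClosed := by
    simp only [Set.ofPred_forall]
    exact isClosed_iInter fun i => isClosed_iInter fun n => isClosed_window_mem i n _
  mapsTo g x hx i n := by rw [window_shift]; exact hx _ _

/-- Compactness: configurations whose central window is in the language form nested nonempty closed
sets. -/
theorem subshift_nonempty [Nonempty A] : T.subshift.carrier.Nonempty := by
  let K : ℕ → Set (ℤ → A) := fun n => {x | window x (-n) (2 * n) ∈ T.language}
  have hK : (⋂ n, K n).Nonempty := by
    refine IsCompact.nonempty_iInter_of_sequence_nonempty_isCompact_isClosed K (fun n x hx => ?_)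
      (fun n => ?_) (isClosed_window_mem _ _ _).isCompact fun n => isClosed_window_mem _ _ _
    · exact language_of_infix hx (window_infix x (by push_cast; omega) (by push_cast; omega))
    · obtain ⟨w, hw⟩ := T.blocks_nonempty (2 * n)
      have hl : (w.take (2 * n)).length = 2 * n := by
        rw [List.length_take, T.length_eq _ w hw]
        exact min_eq_left (Nat.lt_two_pow_self).le
      obtain ⟨x, hx⟩ := exists_window_eq (w.take (2 * n)) (-n)
      rw [hl] at hx
      exact ⟨x, _, w, hw, hx ▸ (List.take_prefix _ _).isInfix⟩
  obtain ⟨x, hx⟩ := hK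
  refine ⟨x, fun i n => ?_⟩
  exact language_of_infix (Set.mem_iInter.1 hx (i.natAbs + n))
    (window_infix x (by omega) (by omega))

theorem block_infix_window {x : ℤ → A} (hx : x ∈ T.subshift.carrier) (i : ℤ) (k : ℕ) :
    ∃ w ∈ T.blocks k, w <:+: window x i (2 * 2 ^ k) :=
  exists_block_infix_of_mem_language (hx i _) (by simp)

theorem Spreading.exists_window_eq (hT : T.Spreading)
    (hcard : ∀ k, 2 * (T.heads k).card ≤ (T.blocks k).card + 1)
    (htwo : ∀ k, 2 ≤ (T.blocks k).card) {u : List A} (hu : u ∈ T.language)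
    {x : ℤ → A} (hx : x ∈ T.subshift.carrier) : ∃ i, window x i u.length = u := by
  obtain ⟨k, hk⟩ := hT.exists_forall_infix hcard htwo hu
  obtain ⟨w, hw, hwx⟩ := block_infix_window hx 0 k
  exact exists_window_eq_of_infix ((hk w hw).trans hwx)

/-- Every central window of `x` occurs in `z`, so suitable shifts of `z` converge to `x`. -/
theorem Spreading.minimalSubshift [Nonempty A] (hT : T.Spreading)
    (hcard : ∀ k, 2 * (T.heads k).card ≤ (T.blocks k).card + 1)
    (htwo : ∀ k, 2 ≤ (T.blocks k).card) : MinimalSubshift T.subshift := by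
  refine ⟨subshift_nonempty, fun Z ⟨z, hz⟩ hZ => hZ.antisymm fun x hx => ?_⟩
  have h : ∀ n : ℕ, ∃ i, window z i (2 * n) = window x (-n) (2 * n) := fun n => by
    simpa using hT.exists_window_eq hcard htwo (hx (-n) (2 * n)) (hZ hz)
  choose i hi using h
  refine Z.isClosed.mem_of_tendsto (f := fun n : ℕ => shift (i n + n) z) (b := Filter.atTop)
    ?_ (Filter.Eventually.of_forall fun n => Z.mapsTo _ hz)
  refine tendsto_pi_nhds.2 fun j => tendsto_const_nhds.congr' ?_
  filter_upwards [Filter.eventually_gt_atTop j.natAbs] with n hn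
  have := window_eq_window_iff.1 (hi n) (j + n).toNat (by omega)
  rw [Int.toNat_of_nonneg (by omega)] at this
  rw [shift_apply, add_assoc, add_comm (n : ℤ) j, this]
  congr 1; ring

theorem Spreading.card_blocks_le_complexity [Nonempty A] (hT : T.Spreading)
    (hcard : ∀ k, 2 * (T.heads k).card ≤ (T.blocks k).card + 1)
    (htwo : ∀ k, 2 ≤ (T.blocks k).card) (k : ℕ) :
    (T.blocks k).card ≤ complexity T.subshift (2 ^ k) := by
  obtain ⟨x, hx⟩ := subshift_nonempty (T := T)
  have : (T.blocks k : Set (List A)) ⊆ List.ofFn '' factors T.subshift (2 ^ k) := by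
    intro w hw
    obtain ⟨i, hi⟩ := hT.exists_window_eq hcard htwo ⟨k, w, hw, List.infix_rfl⟩ hx
    rw [T.length_eq k w hw] at hi
    exact ⟨_, ⟨x, hx, i, fun j => rfl⟩, hi⟩
  rw [← Set.ncard_coe_finset]
  exact (Set.ncard_le_ncard this ((finite_factors _ _).image _)).trans
    (Set.ncard_image_le (finite_factors _ _))

theorem complexity_le {n k : ℕ} (hn : 0 < n) (hk : n ≤ 2 ^ k) :
    complexity T.subshift n ≤ 2 ^ (k + 1) * (2 * (T.blocks (k + 1)).card) := by
  let P : Finset (List A) := Finset.image₂ (· ++ ·) (T.heads k) (T.blocks k) ∪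
    Finset.image₂ (· ++ ·) (T.blocks k) (T.heads k)
  let Q : Finset (List A) := Finset.image₂ (fun i w => (w.drop i).take n)
    (Finset.range (2 ^ (k + 1))) P
  have hP : P.card ≤ 2 * (T.blocks (k + 1)).card := by
    refine (Finset.card_union_le _ _).trans ?_
    have h1 := Finset.card_image₂_le (fun v w : List A => v ++ w) (T.heads k) (T.blocks k)
    have h2 := Finset.card_image₂_le (fun v w : List A => v ++ w) (T.blocks k) (T.heads k)
    rw [T.card_blocks_succ]
    rw [mul_comm] at h2
    omega
  have hsub : List.ofFn '' factors T.subshift n ⊆ (Q : Set (List A)) := by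
    rintro _ ⟨u, ⟨x, hx, i, hu⟩, rfl⟩
    obtain rfl : u = fun j : Fin n => x (i + (j : ℕ)) := funext hu
    obtain ⟨c, hc, w, hw, h⟩ := infix_head_block_of_mem_language (hx i n) (k := k) (by simpa)
    have key : ∀ v ∈ P, window x i n <:+: v → window x i n ∈ Q := by
      rintro v hv ⟨a, b, rfl⟩
      refine Finset.mem_image₂.2 ⟨a.length, ?_, _, hv, ?_⟩
      · have hlen : (a ++ window x i n ++ b).length = 2 ^ (k + 1) := by
          rcases Finset.mem_union.1 hv with hv | hv <;>
            obtain ⟨v₁, h₁, v₂, h₂, h⟩ := Finset.mem_image₂.1 hv <;> rw [← h, List.length_append]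
          · rw [T.length_eq k _ (T.heads_subset k h₁), T.length_eq k _ h₂, pow_succ, mul_two]
          · rw [T.length_eq k _ (T.heads_subset k h₂), T.length_eq k _ h₁, pow_succ, mul_two]
        simp only [List.length_append, length_window] at hlen
        rw [Finset.mem_range]; omega
      · rw [List.append_assoc, List.drop_left', List.take_left'] <;> simp
    rcases h with h | h
    · exact key _ (Finset.mem_union_left _ (Finset.mem_image₂_of_mem hc hw)) h
    · exact key _ (Finset.mem_union_right _ (Finset.mem_image₂_of_mem hw hc)) h
  calc complexity T.subshift n = (List.ofFn '' factors T.subshift n).ncard :=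
        (Set.ncard_image_of_injective _ List.ofFn_injective).symm
    _ ≤ Q.card := by
        rw [← Set.ncard_coe_finset]; exact Set.ncard_le_ncard hsub Q.finite_toSet
    _ ≤ (Finset.range (2 ^ (k + 1))).card * P.card := Finset.card_image₂_le _ _ _
    _ ≤ _ := by rw [Finset.card_range]; gcongr

end BlockTower

/-! ### Existence of an invariant measure -/

section Invariant

open Filter Topology BoundedContinuousFunction

variable {Y : Type*} [TopologicalSpace Y] [MeasurableSpace Y] [BorelSpace Y]

/-- The uniform distribution on the first `n + 1` points of the orbit of `x`. -/
noncomputable def empiricalMeasure (T : Y → Y) (x : Y) (n : ℕ) : Measure Y :=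
  ((n + 1 : ℕ) : ENNReal)⁻¹ • ∑ i ∈ Finset.range (n + 1), Measure.dirac (T^[i] x)

omit [TopologicalSpace Y] [BorelSpace Y] in
instance isProbabilityMeasure_empiricalMeasure (T : Y → Y) (x : Y) (n : ℕ) :
    IsProbabilityMeasure (empiricalMeasure T x n) := by
  constructor
  simp only [empiricalMeasure, Measure.smul_apply, Measure.finsetSum_apply, measure_univ,
    Finset.sum_const, Finset.card_range, smul_eq_mul, nsmul_eq_mul, mul_one]
  exact ENNReal.inv_mul_cancel (by simp) (by simp)

theorem integral_empiricalMeasure (T : Y → Y) (x : Y) (n : ℕ) (g : Y →ᵇ ℝ) :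
    ∫ y, g y ∂(empiricalMeasure T x n) =
      ((n + 1 : ℕ) : ℝ)⁻¹ * ∑ i ∈ Finset.range (n + 1), g (T^[i] x) := by
  rw [empiricalMeasure, integral_smul_measure, integral_finsetSum_measure]
  · have : ∀ y, ∫ z, g z ∂(Measure.dirac y) = g y := fun y =>
      integral_dirac' _ _ g.continuous.stronglyMeasurable
    rw [ENNReal.toReal_inv, ENNReal.toReal_natCast, smul_eq_mul]
    simp only [this]
  · intro i _
    exact g.integrable _

/-- The **Krylov–Bogolyubov theorem** for a homeomorphism of a compact metrizable space. -/
theorem exists_invariant_probabilityMeasure [CompactSpace Y] [T2Space Y] [HasOuterApproxClosed Y]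
    [Nonempty Y] (T : Y ≃ₜ Y) :
    ∃ μ : Measure Y, IsProbabilityMeasure μ ∧ MeasurePreserving T μ μ := by
  obtain ⟨x⟩ := ‹Nonempty Y›
  let ν : ℕ → ProbabilityMeasure Y := fun n => ⟨empiricalMeasure T x n, inferInstance⟩
  let F : Ultrafilter ℕ := Ultrafilter.of atTop
  have hF : (F : Filter ℕ) ≤ atTop := Ultrafilter.of_le _
  obtain ⟨μ, -, hμ⟩ := isCompact_univ.ultrafilter_le_nhds (F.map ν) (by simp)
  have hlim : ∀ g : Y →ᵇ ℝ, Tendsto (fun n => ∫ y, g y ∂(empiricalMeasure T x n)) F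
      (𝓝 (∫ y, g y ∂(μ : Measure Y))) :=
    ProbabilityMeasure.tendsto_iff_forall_integral_tendsto.1 (show Tendsto ν F (𝓝 μ) from hμ)
  have hT : Measurable T := T.continuous.measurable
  refine ⟨μ, inferInstance, hT, ?_⟩
  have : IsProbabilityMeasure ((μ : Measure Y).map T) :=
    Measure.isProbabilityMeasure_map hT.aemeasurable
  refine ext_of_forall_integral_eq_of_IsFiniteMeasure fun g => ?_
  rw [integral_map hT.aemeasurable g.continuous.aestronglyMeasurable]
  let g' : Y →ᵇ ℝ := g.compContinuous ⟨T, T.continuous⟩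
  -- The difference of the two orbit averages telescopes to two boundary terms divided by n + 1.
  have hdiff : Tendsto (fun n => ∫ y, g' y ∂(empiricalMeasure T x n) -
      ∫ y, g y ∂(empiricalMeasure T x n)) F (𝓝 0) := by
    refine Tendsto.mono_left ?_ hF
    have hbound : ∀ n : ℕ, ‖∫ y, g' y ∂(empiricalMeasure T x n) -
        ∫ y, g y ∂(empiricalMeasure T x n)‖ ≤ 2 * ‖g‖ * (1 / ((n : ℝ) + 1)) := by
      intro n
      rw [integral_empiricalMeasure, integral_empiricalMeasure, ← mul_sub,
        ← Finset.sum_sub_distrib]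
      have htel : ∑ i ∈ Finset.range (n + 1), (g' (T^[i] x) - g (T^[i] x)) =
          g (T^[n + 1] x) - g (T^[0] x) := by
        rw [← Finset.sum_range_sub (fun i => g (T^[i] x))]
        refine Finset.sum_congr rfl fun i _ => ?_
        rw [Function.iterate_succ_apply']
        rfl
      rw [htel, norm_mul]
      have h1 := g.norm_coe_le_norm (T^[n + 1] x)
      have h2 := g.norm_coe_le_norm (T^[0] x)
      have h3 := norm_sub_le (g (T^[n + 1] x)) (g (T^[0] x))
      have h4 : ‖((n + 1 : ℕ) : ℝ)⁻¹‖ = 1 / ((n : ℝ) + 1) := by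
        rw [norm_inv, Real.norm_natCast, one_div]; push_cast; rfl
      rw [h4, mul_comm]
      gcongr
      linarith
    refine squeeze_zero_norm hbound ?_
    simpa using (tendsto_one_div_add_atTop_nhds_zero_nat (𝕜 := ℝ)).const_mul (2 * ‖g‖)
  exact sub_eq_zero.1 (tendsto_nhds_unique ((hlim g').sub (hlim g)) hdiff)

end Invariant

/-! ### Measures are determined by cylinders -/

section Uniqueness

variable {A : Type*} [Finite A] [MeasurableSpace A] [MeasurableSingletonClass A]

/-- A finite measure on a space of configurations is determined by its values on cylinders. -/
theorem measure_eq_of_cylinders {S : Set (ℤ → A)} {μ ν : Measure S} [IsFiniteMeasure μ]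
    [IsFiniteMeasure ν]
    (h : ∀ (i : ℤ) (u : List A), μ {x | window x.1 i u.length = u} =
      ν {x | window x.1 i u.length = u}) : μ = ν := by
  have hval : Measurable (Subtype.val : S → ℤ → A) := measurable_subtype_coe
  have hcoord : ∀ (i : ℤ) (n : ℕ),
      Measurable fun (x : S) (j : Fin n) => x.1 (i + (j : ℕ)) := fun i n =>
    measurable_pi_lambda _ fun j => (measurable_pi_apply _).comp hval
  have hfin : ∀ (i : ℤ) (n : ℕ), μ.map (fun (x : S) (j : Fin n) => x.1 (i + (j : ℕ))) =
      ν.map (fun (x : S) (j : Fin n) => x.1 (i + (j : ℕ))) := by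
    intro i n
    refine Measure.ext_of_singleton fun v => ?_
    rw [Measure.map_apply (hcoord i n) (measurableSet_singleton v),
      Measure.map_apply (hcoord i n) (measurableSet_singleton v)]
    have hset : (fun (x : S) (j : Fin n) => x.1 (i + (j : ℕ))) ⁻¹' {v} =
        {x : S | window x.1 i (List.ofFn v).length = List.ofFn v} := by
      ext x
      have : window x.1 i (List.ofFn v).length = window x.1 i n := by rw [List.length_ofFn]
      change _ = v ↔ window x.1 i (List.ofFn v).length = List.ofFn v
      rw [this, window, List.ofFn_inj]
    rw [hset]
    exact h i _
  have hmap : μ.map Subtype.val = ν.map Subtype.val := by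
    refine IsProjectiveLimit.unique (P := fun I => (ν.map Subtype.val).map I.restrict)
      (fun I => ?_) (fun I => rfl)
    have hI : Measurable (I.restrict : (ℤ → A) → I → A) :=
      measurable_pi_lambda _ fun _ => measurable_pi_apply _
    obtain ⟨N, hN⟩ : ∃ N : ℕ, ∀ i ∈ I, i.natAbs < N :=
      ⟨I.sup Int.natAbs + 1, fun i hi => Nat.lt_succ_of_le (Finset.le_sup (f := Int.natAbs) hi)⟩
    let g : (Fin (2 * N) → A) → I → A := fun v i =>
      v ⟨(i.1 + N).toNat, by have := hN i.1 i.2; omega⟩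
    have hg : Measurable g := measurable_pi_lambda _ fun _ => measurable_pi_apply _
    have hfac : I.restrict ∘ (Subtype.val : S → ℤ → A) =
        g ∘ fun (x : S) (j : Fin (2 * N)) => x.1 (-N + (j : ℕ)) := by
      ext x i
      have := hN i.1 i.2
      change x.1 i.1 = x.1 (-N + ((i.1 + N).toNat : ℕ))
      exact congrArg x.1 (show (i.1 : ℤ) = -N + ((i.1 + N).toNat : ℕ) by omega)
    change (μ.map Subtype.val).map I.restrict = (ν.map Subtype.val).map I.restrict
    rw [Measure.map_map hI hval, Measure.map_map hI hval, hfac,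
      ← Measure.map_map hg (hcoord _ _), ← Measure.map_map hg (hcoord _ _), hfin]
  ext s hs
  obtain ⟨t, ht, rfl⟩ := hs
  rw [← Measure.map_apply hval ht, ← Measure.map_apply hval ht, hmap]

theorem measurableSet_cylinder (S : Set (ℤ → A)) (i : ℤ) (u : List A) :
    MeasurableSet {x : S | window x.1 i u.length = u} := by
  have hcoord : Measurable fun (x : S) (j : Fin u.length) => x.1 (i + (j : ℕ)) :=
    measurable_pi_lambda _ fun j => (measurable_pi_apply _).comp measurable_subtype_coe
  exact hcoord (Set.toFinite {v : Fin u.length → A | List.ofFn v = u}).measurableSet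

end Uniqueness

/-! ### Unique ergodicity -/

namespace BlockTower

variable {A : Type*} [DecidableEq A] [Finite A] [TopologicalSpace A] [DiscreteTopology A]
  [MeasurableSpace A] [BorelSpace A] {T : BlockTower A}

/-- Averaging the occurrences of `u` in a long window against an invariant measure. -/
theorem measureReal_cylinder_mem_Icc {u : List A} {α β B : ℝ}
    (h : ∀ y ∈ T.language, α * y.length - B ≤ occ u y ∧ (occ u y : ℝ) ≤ β * y.length + B)
    {μ : Measure T.subshift.carrier} [IsProbabilityMeasure μ]
    (hμ : MeasurePreserving (shiftHomeomorph T.subshift) μ μ) (i : ℤ) :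
    μ.real {x | window x.1 i u.length = u} ∈ Set.Icc α β := by
  set σ := shiftHomeomorph T.subshift
  set E : Set T.subshift.carrier := {x | window x.1 i u.length = u} with hE
  have hEm : MeasurableSet E := measurableSet_cylinder _ i u
  have hiter : ∀ (j : ℕ) (x : T.subshift.carrier) (k : ℤ) (n : ℕ),
      window (σ^[j] x).1 k n = window x.1 (k + j) n := by
    intro j
    induction j with
    | zero => simp
    | succ j ih =>
      intro x k n
      rw [Function.iterate_succ_apply', show (σ (σ^[j] x)).1 = shift 1 (σ^[j] x).1 from rfl,
        window_shift, ih]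
      congr 1; push_cast; ring
  have hpre : ∀ j : ℕ, (σ^[j]) ⁻¹' E = {x | window x.1 (i + j) u.length = u} := fun j => by
    ext x; simp [hE, hiter]
  have hmeas : ∀ j : ℕ, μ.real {x | window x.1 (i + j) u.length = u} = μ.real E := fun j => by
    rw [← hpre, measureReal_def, (hμ.iterate j).measure_preimage hEm.nullMeasurableSet,
      measureReal_def]
  -- By invariance this count of occurrences integrates to `n * μ.real E`; the pointwise frequency
  -- bounds then give the claim as n grows.
  let f : ℕ → T.subshift.carrier → ℝ := fun n x =>
    ∑ j ∈ Finset.range n, {x : T.subshift.carrier | window x.1 (i + j) u.length = u}.indicator 1 x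
  have hint : ∀ j : ℕ, Integrable
      ({x : T.subshift.carrier | window x.1 (i + j) u.length = u}.indicator
        (1 : T.subshift.carrier → ℝ)) μ :=
    fun j => (integrable_const (1 : ℝ)).indicator (measurableSet_cylinder _ _ _)
  have hfint : ∀ n, Integrable (f n) μ := fun n => integrable_finsetSum _ fun j _ => hint j
  have hf : ∀ n, ∫ x, f n x ∂μ = n * μ.real E := by
    intro n
    rw [integral_finsetSum _ fun j _ => hint j]
    simp_rw [fun j : ℕ => integral_indicator_one (μ := μ)
      (measurableSet_cylinder T.subshift.carrier (i + j) u), hmeas]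
    simp
  have hfsum : ∀ n x, f n x = ((∑ j ∈ Finset.range n,
      if window x.1 (i + j) u.length = u then 1 else 0 : ℕ) : ℝ) := by
    intro n x
    push_cast
    refine Finset.sum_congr rfl fun j _ => ?_
    simp [Set.indicator_apply]
  have hlow : ∀ n : ℕ, α * n - B ≤ n * μ.real E := by
    intro n
    rw [← hf n]
    calc α * n - B = ∫ _, (α * n - B) ∂μ := by simp
      _ ≤ ∫ x, f n x ∂μ := by
        refine integral_mono (integrable_const _) (hfint n) fun x => ?_
        have h1 := (h _ (x.2 i n)).1
        rw [length_window] at h1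
        refine h1.trans ?_
        rw [hfsum]
        exact_mod_cast occ_window_le_sum u x.1 i n
  have hupp : ∀ n : ℕ, n * μ.real E ≤ β * n + (β * u.length + B) := by
    intro n
    rw [← hf n]
    calc ∫ x, f n x ∂μ ≤ ∫ _, (β * n + (β * u.length + B)) ∂μ := by
          refine integral_mono (hfint n) (integrable_const _) fun x => ?_
          have h1 := (h _ (x.2 i (n + u.length))).2
          rw [length_window, Nat.cast_add] at h1
          have h2 : f n x ≤ occ u (window x.1 i (n + u.length)) := by
            rw [hfsum]
            exact_mod_cast sum_le_occ_window u x.1 i n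
          linarith
      _ = _ := by simp
  have harch : ∀ a b : ℝ, (∀ n : ℕ, a * n ≤ b) → a ≤ 0 := by
    intro a b hab
    by_contra! ha
    obtain ⟨n, hn⟩ := exists_nat_gt (b / a)
    rw [div_lt_iff₀ ha] at hn
    linarith [hab n]
  constructor
  · have := harch (α - μ.real E) B fun n => by linarith [hlow n]
    linarith
  · have := harch (μ.real E - β) (β * u.length + B) fun n => by linarith [hupp n]
    linarith

/-- Any two invariant measures give a cylinder values in one interval of length ε. -/
theorem Balancing.uniquelyErgodic [Nonempty A] (hT : T.Balancing) :
    UniquelyErgodic (shiftHomeomorph T.subshift) := by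
  have : CompactSpace T.subshift.carrier :=
    isCompact_iff_compactSpace.1 T.subshift.isClosed.isCompact
  have : Nonempty T.subshift.carrier := subshift_nonempty.to_subtype
  let := TopologicalSpace.metrizableSpaceMetric A
  obtain ⟨μ, hμ, hμT⟩ := exists_invariant_probabilityMeasure (shiftHomeomorph T.subshift)
  refine ⟨μ, ⟨hμ, hμT⟩, ?_⟩
  rintro ν ⟨hν, hνT⟩
  refine measure_eq_of_cylinders fun i u => ?_
  have hreal : ν.real {x | window x.1 i u.length = u} = μ.real {x | window x.1 i u.length = u} := by
    refine eq_of_forall_dist_le fun ε hε => ?_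
    obtain ⟨α, B, h⟩ := hT.exists_frequency u (half_pos hε)
    have h1 := measureReal_cylinder_mem_Icc h hμT i
    have h2 := measureReal_cylinder_mem_Icc h hνT i
    rw [Real.dist_eq, abs_le]
    constructor <;> linarith [h1.1, h1.2, h2.1, h2.2]
  exact (measureReal_eq_measureReal_iff).1 hreal

end BlockTower

/-! ### The theorem -/

theorem Submultiplicative.pos {f : ℕ → ℕ} (hmono : Monotone f) (hsub : Submultiplicative f)
    (hne : f ≠ 0) {n : ℕ} (hn : 1 ≤ n) : 0 < f n := by
  refine lt_of_lt_of_le (Nat.pos_of_ne_zero fun h1 => hne ?_) (hmono hn)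
  have hzero : ∀ m, f (m + 1) = 0 := by
    intro m
    induction m with
    | zero => exact h1
    | succ m ih => simpa [h1] using hsub (m + 1) 1 (by omega) le_rfl
  funext m
  exact Nat.le_zero.1 ((hmono (Nat.le_succ m)).trans (hzero m).le)

theorem theorem1p3 (f : ℕ → ℕ) (hmono : Monotone f) (hsub : Submultiplicative f) (hne : f ≠ 0) :
    ∃ (b : ℕ) (X : Subshift (Fin b) ℤ),
      StrictlyErgodic X ∧
        AsympLE f (complexity X) ∧
        AsympLE (complexity X) (fun n => n * f n) := by
  have hpos : ∀ n, 1 ≤ n → 0 < f n := fun n hn => hsub.pos hmono hne hn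
  have hFpos : ∀ k, 0 < f (2 ^ k) := fun k => hpos _ Nat.one_le_two_pow
  obtain ⟨T, hlow, hupp, hheads, hbal, hspr⟩ := exists_blockTower (A := Fin (2 * f (2 ^ 0)))
    (F := fun k => f (2 ^ k)) hFpos
    (fun k => hmono (Nat.pow_le_pow_right two_pos (Nat.le_succ k)))
    (fun k => by
      have := hsub (2 ^ k) (2 ^ k) Nat.one_le_two_pow Nat.one_le_two_pow
      rwa [← mul_two, ← pow_succ] at this)
    (by simp)
  have : Nonempty (Fin (2 * f (2 ^ 0))) := ⟨⟨0, by have := hFpos 0; omega⟩⟩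
  have htwo : ∀ k, 2 ≤ (T.blocks k).card := fun k => by
    have h1 : 2 * f (2 ^ k) ≤ (T.blocks k).card := hlow k
    have := hFpos k
    omega
  refine ⟨_, T.subshift, ⟨hspr.minimalSubshift hheads htwo, hbal.uniquelyErgodic⟩,
    -- Both bounds use a `k` with n ≤ 2^k ≤ 2n. The upper one involves level k + 1, with 2^{k+1} ≤
    -- 4n, hence the dilation 4.
    ⟨1, 2, one_pos, two_pos, ?_⟩, ⟨16, 4, by norm_num, by norm_num, ?_⟩⟩ <;>
  · filter_upwards [Filter.eventually_ge_atTop 1] with n hn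
    obtain ⟨k, hk, hk'⟩ : ∃ k, n ≤ 2 ^ k ∧ 2 ^ k ≤ 2 * n := by
      refine ⟨Nat.clog 2 n, Nat.le_pow_clog one_lt_two n, ?_⟩
      rcases hn.eq_or_lt with rfl | hn
      · simp
      · have h1 := Nat.pow_pred_clog_lt_self one_lt_two hn
        have h2 := Nat.clog_pos one_lt_two hn
        obtain ⟨j, hj⟩ := Nat.exists_eq_succ_of_ne_zero h2.ne'
        rw [hj] at h1 ⊢
        rw [pow_succ]
        simp only [Nat.pred_eq_sub_one, Nat.succ_sub_one] at h1
        omega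
    first
    | calc f n ≤ f (2 ^ k) := hmono hk
        _ ≤ 2 * f (2 ^ k) := by omega
        _ ≤ (T.blocks k).card := hlow k
        _ ≤ complexity T.subshift (2 ^ k) := hspr.card_blocks_le_complexity hheads htwo k
        _ ≤ complexity T.subshift (2 * n) := complexity_mono _ hk'
        _ = 1 * complexity T.subshift (2 * n) := (one_mul _).symm
    | have hk4 : 2 ^ (k + 1) ≤ 4 * n := by rw [pow_succ]; omega
      calc complexity T.subshift n ≤ 2 ^ (k + 1) * (2 * (T.blocks (k + 1)).card) :=
            BlockTower.complexity_le hn hk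
        _ ≤ (4 * n) * (2 * (4 * f (4 * n))) := by
            gcongr
            exact (hupp (k + 1)).trans (Nat.mul_le_mul_left _ (hmono hk4))
        _ ≤ 16 * (4 * n * f (4 * n)) := by nlinarith [Nat.zero_le (n * f (4 * n))]
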